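/- Let $V$ be a finite-dimensional real vector space, and let $C\subseteq V$ be a closed pointed convex linear cone with $\dim C\ge 2$; that is, $C$ is a nonempty closed convex set with $\lambda x\in C$ for all $x\in C$ and $\lambda\ge 0$, and there is a linear hyperplane $H\subset V$ with $H\cap C=\{0\}$. (The dimension of a set is the dimension of its affine span.) Then the following are equivalent: 1. (Flat boundary intersections.) For every $a$ in the relative interior of $C$, the affine span of $\partial C\cap\partial(a-C)$ has dimension $\dim C-1$, where $\partial K$ denotes the boundary of $K$ relative to its affine span and $a-C=\{a-x : x\in C\}$. 2. ($C$ is ellipsoidal, i.e. a cone over an ellipsoid.) There is an affine hyperplane $A\subset V$ such that $A\cap C$ has dimension $\dim C-1$ and is a solid ellipsoid, that is, the image of the closed unit ball of some Euclidean space under an affine map. -/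

import Mathlib

namespace FBI

/-- The dimension of a subset of a real vector space, that is, the dimension of its affine span,
with the convention that the empty set has dimension `-1`. -/
noncomputable def setDim {V : Type*} [AddCommGroup V] [Module ℝ V] (s : Set V) : ℤ :=
  open Classical in
  if s = ∅ then -1 else (Module.finrank ℝ (affineSpan ℝ s).direction : ℤ)

/-- Affine hyperplanes: nonempty affine subspaces of codimension one. -/
def IsAffineHyperplane {V : Type*} [AddCommGroup V] [Module ℝ V] (H : AffineSubspace ℝ V) : Prop :=
  (H : Set V).Nonempty ∧ Module.finrank ℝ H.direction + 1 = Module.finrank ℝ V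

/-- Closed pointed convex linear cones. Pointed means that some linear hyperplane meets the
cone in `0` only. -/
structure IsClosedPointedCone {V : Type*} [AddCommGroup V] [Module ℝ V] [TopologicalSpace V]
    (C : Set V) : Prop where
  nonempty : C.Nonempty
  convex : Convex ℝ C
  smul_mem : ∀ x ∈ C, ∀ r : ℝ, 0 ≤ r → r • x ∈ C
  isClosed : IsClosed C
  pointed : ∃ H : Submodule ℝ V,
    Module.finrank ℝ H + 1 = Module.finrank ℝ V ∧ (H : Set V) ∩ C = {0}

/-- `S` is a section of `K`: an intersection of `K` with an affine hyperplane that has dimension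
`dim K - 1`. -/
def IsSection {V : Type*} [AddCommGroup V] [Module ℝ V] (K S : Set V) : Prop :=
  (∃ H : AffineSubspace ℝ V, IsAffineHyperplane H ∧ S = K ∩ (H : Set V)) ∧
    setDim S = setDim K - 1

/-- Solid ellipsoids: images of the closed unit ball of a Euclidean space under an affine map. -/
def IsEllipsoid {V : Type*} [AddCommGroup V] [Module ℝ V] (S : Set V) : Prop :=
  ∃ (m : ℕ) (f : EuclideanSpace ℝ (Fin m) →ᵃ[ℝ] V), S = f '' Metric.closedBall 0 1

/-- A cone is ellipsoidal (a cone over an ellipsoid) if some section of it is an ellipsoid. -/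
def IsEllipsoidal {V : Type*} [AddCommGroup V] [Module ℝ V] (C : Set V) : Prop :=
  ∃ S : Set V, IsSection C S ∧ IsEllipsoid S

/-- The flat boundary intersections property: for every `a` in the relative interior of `C`, the
affine span of `∂C ∩ ∂(a - C)` has dimension `dim C - 1`. Boundaries are taken relative to the
affine span. -/
def HasFBI {V : Type*} [AddCommGroup V] [Module ℝ V] [TopologicalSpace V] (C : Set V) : Prop :=
  ∀ a ∈ intrinsicInterior ℝ C,
    setDim (intrinsicFrontier ℝ C ∩ intrinsicFrontier ℝ ((fun x : V => a - x) '' C))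
      = setDim C - 1

end FBI

/-!
Both implications are proved for cones with nonempty interior, and `hasFBI_image_iff` carries them
over to a cone in its linear span.

Suppose that `K` has flat boundary intersections. The set `∂K ∩ ∂(a - K)` meets every boundary ray,
and the boundary rays span the space, so the affine span of this set misses the origin and there
is a linear functional `φ a` that is `1` on the set (`IsSolidCone.exists_isFlatFamily`). If `v ≠ 0`
is a boundary point and `s • v` is the point of its ray with `a - s • v ∈ ∂K`, then
`φ a v = s⁻¹`, so the map `x ↦ φ a x • a - x` sends `v` to the boundary point `s⁻¹ • (a - s • v)`.
This map is therefore a linear involution preserving `K`; it fixes `a` and is `-1` on the kernel of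
`φ a`. Involutions preserve volume, so the volume of `K ∩ (a - K)`, a function of `a` that is
homogeneous of degree `n = dim K`, is invariant under all these reflections. Let `q` be its power
with exponent `2 / n`. Two interior points lie in a plane spanned by boundary points `p` and `r`,
and a suitable reflection shows that `q (α • p + β • r)` is a constant multiple of `α * β`
(`intervalForm_combination`). Since `φ (α • p + β • r)` is `α⁻¹` at `p` and `β⁻¹` at `r`, it follows
that `q a * φ a b = q b * φ b a` for all interior points (`intervalForm_mul_symm`). The two sides are
linear in `b` and in `a` respectively, so there is a symmetric bilinear form `B` with
`B a = q a • φ a`. Its quadratic form vanishes on the boundary of `K`, because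
on the plane of `p` and `r` it has no squares. A line in the direction of `x ∈ ker (φ e)`
through an interior point `e` leaves `K` where `B e e + s ^ 2 * B x x = 0`; hence `-B` is positive
definite on `ker (φ e)`, and the section of `K` by the parallel hyperplane through `e` is a ball of
this form (`IsFlatFamily.exists_ellipsoidal_section`).

Conversely, an ellipsoidal cone is a linear image of `{(t, y) : ‖y‖ ≤ t}`
(`exists_ballCone_of_isEllipsoidal`), for which `∂K ∩ ∂(a - K)` is the intersection of the light
cone with the hyperplane of points whose Lorentz product with `a` is half the Lorentz square of
`a`; that it spans this hyperplane is `setDim_frontier_inter_ballCone`.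
-/

/-! ### Solid cones -/

/-- Closed convex cones with nonempty interior on which some linear functional is positive away
from the origin. -/
structure IsSolidCone {E : Type*} [NormedAddCommGroup E] [NormedSpace ℝ E] (K : Set E) :
    Prop where
  convex : Convex ℝ K
  smul_mem : ∀ x ∈ K, ∀ r : ℝ, 0 ≤ r → r • x ∈ K
  isClosed : IsClosed K
  interior_nonempty : (interior K).Nonempty
  exists_pos : ∃ ψ : E →ₗ[ℝ] ℝ, ∀ x ∈ K, x ≠ 0 → 0 < ψ x

namespace IsSolidCone

variable {E : Type*} [NormedAddCommGroup E] [NormedSpace ℝ E] {K : Set E}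

theorem add_mem (h : IsSolidCone K) {x y : E} (hx : x ∈ K) (hy : y ∈ K) : x + y ∈ K := by
  have := h.smul_mem _ (h.convex hx hy (a := 1 / 2) (b := 1 / 2) (by norm_num) (by norm_num)
    (by norm_num)) 2 (by norm_num)
  simpa [smul_add, smul_smul] using this

theorem neg_notMem (h : IsSolidCone K) {x : E} (hx : x ∈ K) (hx0 : x ≠ 0) : -x ∉ K := by
  obtain ⟨ψ, hψ⟩ := h.exists_pos
  intro hn
  have h1 := hψ x hx hx0
  have h2 := hψ (-x) hn (neg_ne_zero.2 hx0)
  rw [map_neg] at h2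
  linarith

theorem mem_frontier_iff (h : IsSolidCone K) {x : E} :
    x ∈ frontier K ↔ x ∈ K ∧ x ∉ interior K := by
  rw [h.isClosed.frontier_eq]; rfl

theorem mem_of_mem_frontier (h : IsSolidCone K) {x : E} (hx : x ∈ frontier K) : x ∈ K :=
  (h.mem_frontier_iff.1 hx).1

theorem smul_mem_interior (h : IsSolidCone K) {x : E} (hx : x ∈ interior K) {r : ℝ}
    (hr : 0 < r) : r • x ∈ interior K := by
  have h1 : r • x ∈ (fun z => r • z) '' interior K := ⟨x, hx, rfl⟩
  refine interior_maximal ?_ (isOpenMap_smul₀ hr.ne' _ isOpen_interior) h1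
  rintro _ ⟨y, hy, rfl⟩
  exact h.smul_mem y (interior_subset hy) r hr.le

theorem add_mem_interior (h : IsSolidCone K) {x y : E} (hx : x ∈ interior K) (hy : y ∈ K) :
    x + y ∈ interior K := by
  have h1 : x + y ∈ (fun z => z + y) '' interior K := ⟨x, hx, rfl⟩
  refine interior_maximal ?_ ((Homeomorph.addRight y).isOpenMap _ isOpen_interior) h1
  rintro _ ⟨z, hz, rfl⟩
  exact h.add_mem (interior_subset hz) hy

theorem smul_mem_frontier (h : IsSolidCone K) {x : E} (hx : x ∈ frontier K) {r : ℝ}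
    (hr : 0 < r) : r • x ∈ frontier K := by
  rw [h.mem_frontier_iff] at hx ⊢
  refine ⟨h.smul_mem x hx.1 r hr.le, fun hi => hx.2 ?_⟩
  simpa [smul_smul, hr.ne'] using h.smul_mem_interior hi (inv_pos.2 hr)

/-- A ray from an interior point leaves the cone, unless its direction belongs to the cone. -/
theorem exists_add_smul_mem_frontier (h : IsSolidCone K) {x y : E} (hx : x ∈ interior K)
    (hy : y ∉ K) : ∃ s : ℝ, 0 < s ∧ x + s • y ∈ frontier K := by
  obtain ⟨s, hs0, hs⟩ : ∃ s : ℝ, 0 ≤ s ∧ x + s • y ∉ K := by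
    by_contra! hall
    apply hy
    have ht : Filter.Tendsto (fun s : ℝ => s⁻¹ • x + y) Filter.atTop (nhds ((0 : ℝ) • x + y)) :=
      (tendsto_inv_atTop_zero.smul_const x).add_const y
    rw [zero_smul, zero_add] at ht
    refine h.isClosed.mem_of_tendsto ht ?_
    filter_upwards [Filter.eventually_gt_atTop 0] with s hs
    have := h.smul_mem _ (hall s hs.le) s⁻¹ (inv_nonneg.2 hs.le)
    rwa [smul_add, smul_smul, inv_mul_cancel₀ hs.ne', one_smul] at this
  have hconn : IsPreconnected ((fun t : ℝ => x + t • y) '' Set.Icc 0 s) :=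
    isPreconnected_Icc.image _ (by fun_prop)
  by_contra! hno
  obtain ⟨_, -, hi, hc⟩ := hconn (interior K) Kᶜ isOpen_interior h.isClosed.isOpen_compl
    (by
      rintro _ ⟨t, ht, rfl⟩
      by_cases ht0 : t = 0
      · left; simpa [ht0] using hx
      · have := hno t (lt_of_le_of_ne ht.1 (Ne.symm ht0))
        rw [h.mem_frontier_iff] at this
        by_cases hK : x + t • y ∈ K
        · left; by_contra hn; exact this ⟨hK, hn⟩
        · exact Or.inr hK)
    ⟨_, ⟨0, ⟨le_rfl, hs0⟩, rfl⟩, by simpa using hx⟩ ⟨_, ⟨s, ⟨hs0, le_rfl⟩, rfl⟩, hs⟩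
  exact hc (interior_subset hi)

theorem exists_sub_smul_mem_frontier (h : IsSolidCone K) {x y : E} (hx : x ∈ interior K)
    (hy : y ∈ K) (hy0 : y ≠ 0) : ∃ s : ℝ, 0 < s ∧ x - s • y ∈ frontier K := by
  obtain ⟨s, hs, hf⟩ := h.exists_add_smul_mem_frontier hx (h.neg_notMem hy hy0)
  exact ⟨s, hs, by simpa [sub_eq_add_neg] using hf⟩

theorem exists_mem_frontier_ne_zero (h : IsSolidCone K) (hE : 2 ≤ Module.finrank ℝ E) :
    ∃ v ∈ frontier K, v ≠ 0 := by
  obtain ⟨e, he⟩ := h.interior_nonempty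
  obtain ⟨y, hy⟩ : ∃ y, y ∉ Submodule.span ℝ {e} := by
    by_contra! hall
    have htop : Submodule.span ℝ {e} = ⊤ := Submodule.eq_top_iff'.2 hall
    have := finrank_span_le_card (R := ℝ) ({e} : Set E)
    rw [htop, finrank_top] at this
    simp at this
    omega
  have hy0 : y ≠ 0 := by rintro rfl; exact hy (Submodule.zero_mem _)
  obtain ⟨z, hz, hzK⟩ : ∃ z, z ∉ Submodule.span ℝ {e} ∧ z ∉ K := by
    by_cases hyK : y ∈ K
    · exact ⟨-y, by rwa [Submodule.neg_mem_iff], h.neg_notMem hyK hy0⟩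
    · exact ⟨y, hy, hyK⟩
  obtain ⟨s, hs, hf⟩ := h.exists_add_smul_mem_frontier he hzK
  refine ⟨_, hf, fun h0 => hz ?_⟩
  rw [Submodule.mem_span_singleton]
  refine ⟨-s⁻¹, ?_⟩
  rw [eq_neg_of_add_eq_zero_left h0]
  simp [smul_smul, hs.ne']

theorem span_interior (h : IsSolidCone K) : Submodule.span ℝ (interior K) = ⊤ := by
  apply Submodule.eq_top_of_nonempty_interior'
  obtain ⟨e, he⟩ := h.interior_nonempty
  exact ⟨e, mem_interior.2 ⟨_, Submodule.subset_span, isOpen_interior, he⟩⟩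

theorem span_frontier (h : IsSolidCone K) (hE : 2 ≤ Module.finrank ℝ E) :
    Submodule.span ℝ (frontier K) = ⊤ := by
  obtain ⟨v, hv, hv0⟩ := h.exists_mem_frontier_ne_zero hE
  rw [← top_le_iff, ← h.span_interior, Submodule.span_le]
  intro x hx
  obtain ⟨s, -, hf⟩ := h.exists_sub_smul_mem_frontier hx (h.mem_of_mem_frontier hv) hv0
  have := Submodule.add_mem _ (Submodule.subset_span hf)
    (Submodule.smul_mem _ s (Submodule.subset_span (R := ℝ) hv))
  simpa using this

/-- Two interior points of a solid cone are positive combinations of the same two boundary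
points. -/
theorem exists_common_decomposition (h : IsSolidCone K) (hE : 2 ≤ Module.finrank ℝ E) {a b : E}
    (ha : a ∈ interior K) (hb : b ∈ interior K) (ha0 : a ≠ 0) (hb0 : b ≠ 0) :
    ∃ p ∈ frontier K, ∃ r ∈ frontier K, ∃ α β γ δ : ℝ, 0 < α ∧ 0 < β ∧ 0 < γ ∧ 0 < δ ∧
      a = α • p + β • r ∧ b = γ • p + δ • r := by
  obtain ⟨ψ, hψ⟩ := h.exists_pos
  obtain ⟨s, hs, hp⟩ := h.exists_sub_smul_mem_frontier hb (interior_subset ha) ha0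
  obtain ⟨t, ht, hr⟩ := h.exists_sub_smul_mem_frontier ha (interior_subset hb) hb0
  by_cases hp0 : b - s • a = 0
  · -- here `b` is a multiple of `a`, and any boundary point yields a decomposition
    obtain ⟨v, hv, hv0⟩ := h.exists_mem_frontier_ne_zero hE
    obtain ⟨u, hu, hf⟩ := h.exists_sub_smul_mem_frontier ha (h.mem_of_mem_frontier hv) hv0
    refine ⟨v, hv, _, hf, u, 1, s * u, s, hu, one_pos, by positivity, hs, by simp, ?_⟩
    rw [sub_eq_zero.1 hp0, smul_sub, smul_smul]
    abel
  · have hst : 0 < 1 - s * t := by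
      have h1 := hψ _ (h.mem_of_mem_frontier hp) hp0
      have h2 : 0 ≤ ψ (a - t • b) := by
        by_cases h0 : a - t • b = 0
        · simp [h0]
        · exact (hψ _ (h.mem_of_mem_frontier hr) h0).le
      have h3 := hψ _ (interior_subset hb) hb0
      simp only [map_sub, map_smul, smul_eq_mul] at h1 h2
      have h4 : 0 < (1 - s * t) * ψ b := by nlinarith
      exact pos_of_mul_pos_left h4 h3.le
    have ea : (1 - s * t) • a = t • (b - s • a) + (a - t • b) := by module
    have eb : (1 - s * t) • b = (b - s • a) + s • (a - t • b) := by module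
    set d := 1 - s * t
    refine ⟨_, hp, _, hr, d⁻¹ * t, d⁻¹, d⁻¹, d⁻¹ * s,
      by positivity, by positivity, by positivity, by positivity, ?_, ?_⟩
    · rw [mul_smul, ← smul_add, ← ea, inv_smul_smul₀ hst.ne']
    · rw [mul_smul, ← smul_add, ← eb, inv_smul_smul₀ hst.ne']

/-- Order intervals of a solid cone are bounded. -/
theorem isBounded_inter [FiniteDimensional ℝ E] (h : IsSolidCone K) (a : E) :
    Bornology.IsBounded (K ∩ {x | a - x ∈ K}) := by
  obtain ⟨ψ, hψ⟩ := h.exists_pos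
  have hψc : Continuous ψ := ψ.continuous_of_finiteDimensional
  have hcomp : IsCompact (K ∩ Metric.sphere (0 : E) 1) := by
    rw [Set.inter_comm]
    exact (isCompact_sphere _ _).inter_right h.isClosed
  obtain ⟨c, hc, hcle⟩ : ∃ c : ℝ, 0 < c ∧ ∀ x ∈ K, c * ‖x‖ ≤ ψ x := by
    rcases Set.eq_empty_or_nonempty (K ∩ Metric.sphere (0 : E) 1) with hem | hne
    · refine ⟨1, one_pos, fun x hx => ?_⟩
      by_cases hx0 : x = 0
      · simp [hx0]
      · have : ‖x‖⁻¹ • x ∈ K ∩ Metric.sphere (0 : E) 1 :=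
          ⟨h.smul_mem x hx _ (by positivity), by simp [norm_smul, hx0]⟩
        simp [hem] at this
    · obtain ⟨m, hm, hmin⟩ := hcomp.exists_isMinOn hne hψc.continuousOn
      have hm0 : m ≠ 0 := by
        rintro rfl
        simpa using hm.2
      refine ⟨ψ m, hψ m hm.1 hm0, fun x hx => ?_⟩
      by_cases hx0 : x = 0
      · simp [hx0]
      · have hn : 0 < ‖x‖ := norm_pos_iff.2 hx0
        have : ‖x‖⁻¹ • x ∈ K ∩ Metric.sphere (0 : E) 1 :=
          ⟨h.smul_mem x hx _ (by positivity), by simp [norm_smul, hx0]⟩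
        have h1 : ψ m ≤ ψ (‖x‖⁻¹ • x) := hmin this
        rw [map_smul, smul_eq_mul, inv_mul_eq_div, le_div_iff₀ hn] at h1
        exact h1
  refine (Metric.isBounded_iff_subset_closedBall 0).2 ⟨ψ a / c, fun x hx => ?_⟩
  have h1 := hcle x hx.1
  have h2 := hcle (a - x) hx.2
  rw [map_sub] at h2
  have h3 : 0 ≤ c * ‖a - x‖ := by positivity
  rw [mem_closedBall_zero_iff, le_div_iff₀ hc]
  linarith

end IsSolidCone

/-! ### Flat boundary intersections and reflections -/

/-- For every interior point `a` of `K`, the functional `φ a` takes the value `1` on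
`∂K ∩ ∂(a - K)`. -/
def IsFlatFamily {E : Type*} [NormedAddCommGroup E] [NormedSpace ℝ E] (K : Set E)
    (φ : E → E →ₗ[ℝ] ℝ) : Prop :=
  ∀ a ∈ interior K, ∀ x ∈ frontier K, a - x ∈ frontier K → φ a x = 1

/-- The linear map `x ↦ f x • a - x`. If `f a = 2`, it is the involution that fixes `a` and is `-1`
on the kernel of `f`. -/
def axialReflection {E : Type*} [AddCommGroup E] [Module ℝ E] (f : E →ₗ[ℝ] ℝ) (a : E) :
    E →ₗ[ℝ] E :=
  f.smulRight a - LinearMap.id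

theorem axialReflection_apply {E : Type*} [AddCommGroup E] [Module ℝ E] (f : E →ₗ[ℝ] ℝ)
    (a x : E) : axialReflection f a x = f x • a - x := rfl

theorem axialReflection_axialReflection {E : Type*} [AddCommGroup E] [Module ℝ E]
    {f : E →ₗ[ℝ] ℝ} {a : E} (hf : f a = 2) (x : E) :
    axialReflection f a (axialReflection f a x) = x := by
  simp only [axialReflection_apply, map_sub, map_smul, hf]
  module

theorem abs_det_axialReflection {E : Type*} [AddCommGroup E] [Module ℝ E]
    {f : E →ₗ[ℝ] ℝ} {a : E} (hf : f a = 2) : |(axialReflection f a).det| = 1 := by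
  have h1 : axialReflection f a ∘ₗ axialReflection f a = LinearMap.id :=
    LinearMap.ext fun x => axialReflection_axialReflection hf x
  have h2 := congrArg LinearMap.det h1
  rw [LinearMap.det_comp, LinearMap.det_id] at h2
  have h3 : |(axialReflection f a).det| * |(axialReflection f a).det| = 1 := by
    rw [← abs_mul, h2, abs_one]
  nlinarith [abs_nonneg (axialReflection f a).det]

namespace IsFlatFamily

variable {E : Type*} [NormedAddCommGroup E] [NormedSpace ℝ E] {K : Set E}
  {φ : E → E →ₗ[ℝ] ℝ}

theorem exists_smul_mem_frontier (h : IsSolidCone K) (hφ : IsFlatFamily K φ) {a v : E}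
    (ha : a ∈ interior K) (hv : v ∈ frontier K) (hv0 : v ≠ 0) :
    ∃ s : ℝ, 0 < s ∧ s • v ∈ frontier K ∧ a - s • v ∈ frontier K ∧ φ a v = s⁻¹ := by
  obtain ⟨s, hs, hf⟩ := h.exists_sub_smul_mem_frontier ha (h.mem_of_mem_frontier hv) hv0
  have h1 := hφ a ha _ (h.smul_mem_frontier hv hs) hf
  refine ⟨s, hs, h.smul_mem_frontier hv hs, hf, ?_⟩
  rw [map_smul, smul_eq_mul] at h1
  exact eq_inv_of_mul_eq_one_right h1

theorem apply_combination (h : IsSolidCone K) (hφ : IsFlatFamily K φ) {p r : E}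
    (hp : p ∈ frontier K) (hr : r ∈ frontier K) {x y : ℝ} (hx : 0 < x) (hy : 0 < y)
    (hi : x • p + y • r ∈ interior K) :
    φ (x • p + y • r) p = x⁻¹ ∧ φ (x • p + y • r) r = y⁻¹ := by
  have h1 := hφ _ hi _ (h.smul_mem_frontier hp hx)
    (by rw [add_sub_cancel_left]; exact h.smul_mem_frontier hr hy)
  have h2 := hφ _ hi _ (h.smul_mem_frontier hr hy)
    (by rw [add_sub_cancel_right]; exact h.smul_mem_frontier hp hx)
  rw [map_smul, smul_eq_mul] at h1 h2
  exact ⟨eq_inv_of_mul_eq_one_right h1, eq_inv_of_mul_eq_one_right h2⟩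

theorem pos_of_mem_frontier (h : IsSolidCone K) (hφ : IsFlatFamily K φ) {a v : E}
    (ha : a ∈ interior K) (hv : v ∈ frontier K) (hv0 : v ≠ 0) : 0 < φ a v := by
  obtain ⟨s, hs, -, -, h1⟩ := hφ.exists_smul_mem_frontier h ha hv hv0
  rw [h1]
  positivity

theorem axialReflection_mem_frontier (h : IsSolidCone K) (hφ : IsFlatFamily K φ) {a v : E}
    (ha : a ∈ interior K) (hv : v ∈ frontier K) (hv0 : v ≠ 0) :
    axialReflection (φ a) a v ∈ frontier K := by
  obtain ⟨s, hs, -, h1, h2⟩ := hφ.exists_smul_mem_frontier h ha hv hv0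
  have := h.smul_mem_frontier h1 (inv_pos.2 hs)
  rwa [smul_sub, smul_smul, inv_mul_cancel₀ hs.ne', one_smul, ← h2] at this

theorem _root_.IsSolidCone.exists_mem_frontier_sub_mem (h : IsSolidCone K) (hE : 2 ≤ Module.finrank ℝ E) {a : E}
    (ha : a ∈ interior K) : ∃ p ∈ frontier K, a - p ∈ frontier K ∧ p ≠ 0 := by
  obtain ⟨v, hv, hv0⟩ := h.exists_mem_frontier_ne_zero hE
  obtain ⟨s, hs, h1⟩ := h.exists_sub_smul_mem_frontier ha (h.mem_of_mem_frontier hv) hv0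
  exact ⟨_, h.smul_mem_frontier hv hs, h1, smul_ne_zero hs.ne' hv0⟩

theorem apply_self (h : IsSolidCone K) (hφ : IsFlatFamily K φ) (hE : 2 ≤ Module.finrank ℝ E)
    {a : E} (ha : a ∈ interior K) : φ a a = 2 := by
  obtain ⟨p, hp, hr, -⟩ := h.exists_mem_frontier_sub_mem hE ha
  have h1 := hφ a ha _ hp hr
  have h2 := hφ a ha _ hr (by simpa using hp)
  rw [map_sub, h1] at h2
  linarith

theorem ne_zero (h : IsSolidCone K) (hφ : IsFlatFamily K φ) (hE : 2 ≤ Module.finrank ℝ E)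
    {a : E} (ha : a ∈ interior K) : a ≠ 0 := by
  rintro rfl
  have := hφ.apply_self h hE ha
  simp at this

theorem pos (h : IsSolidCone K) (hφ : IsFlatFamily K φ) (hE : 2 ≤ Module.finrank ℝ E) {a x : E}
    (ha : a ∈ interior K) (hx : x ∈ K) (hx0 : x ≠ 0) : 0 < φ a x := by
  by_cases hi : x ∈ interior K
  · obtain ⟨p, hp, hr, hp0⟩ := h.exists_mem_frontier_sub_mem hE hi
    have h1 := hφ.pos_of_mem_frontier h ha hp hp0
    have h2 : 0 ≤ φ a (x - p) := by
      by_cases h0 : x - p = 0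
      · simp [h0]
      · exact (hφ.pos_of_mem_frontier h ha hr h0).le
    rw [map_sub] at h2
    linarith
  · exact hφ.pos_of_mem_frontier h ha (h.mem_frontier_iff.2 ⟨hx, hi⟩) hx0

/-- The reflection belonging to an interior point preserves the cone. -/
theorem axialReflection_mem (h : IsSolidCone K) (hφ : IsFlatFamily K φ)
    (hE : 2 ≤ Module.finrank ℝ E) {a x : E} (ha : a ∈ interior K) (hx : x ∈ K) :
    axialReflection (φ a) a x ∈ K := by
  have hfr : ∀ v ∈ frontier K, axialReflection (φ a) a v ∈ K := by
    intro v hv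
    by_cases hv0 : v = 0
    · rw [hv0, map_zero, ← hv0]
      exact h.mem_of_mem_frontier hv
    · exact h.mem_of_mem_frontier (hφ.axialReflection_mem_frontier h ha hv hv0)
  by_cases hi : x ∈ interior K
  · obtain ⟨p, hp, hr, -⟩ := h.exists_mem_frontier_sub_mem hE hi
    have := h.add_mem (hfr _ hp) (hfr _ hr)
    rwa [← map_add, add_sub_cancel] at this
  · exact hfr x (h.mem_frontier_iff.2 ⟨hx, hi⟩)

end IsFlatFamily

/-! ### The volume of order intervals -/

section Volume

open MeasureTheory

variable {E : Type*} [NormedAddCommGroup E] [NormedSpace ℝ E] [FiniteDimensional ℝ E]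
  [MeasurableSpace E] [BorelSpace E] {K : Set E} {φ : E → E →ₗ[ℝ] ℝ}

/-- The volume of the order interval `K ∩ (a - K)`. -/
noncomputable def intervalVolume (K : Set E) (a : E) : ℝ :=
  ((Measure.addHaar : Measure E) (K ∩ {x | a - x ∈ K})).toReal

theorem intervalVolume_pos (h : IsSolidCone K) {a : E} (ha : a ∈ interior K) :
    0 < intervalVolume K a := by
  refine ENNReal.toReal_pos (ne_of_gt ?_) (h.isBounded_inter a).measure_lt_top.ne
  refine Measure.measure_pos_of_nonempty_interior _ ⟨(1 / 2 : ℝ) • a, ?_⟩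
  have h2 := h.smul_mem_interior ha (r := 1 / 2) (by norm_num)
  have hc : Continuous fun x : E => a - x := by fun_prop
  refine mem_interior.2 ⟨interior K ∩ (fun x => a - x) ⁻¹' interior K, ?_,
    isOpen_interior.inter (isOpen_interior.preimage hc), h2, ?_⟩
  · exact fun x hx => ⟨interior_subset hx.1, interior_subset (s := K) hx.2⟩
  · have : a - (1 / 2 : ℝ) • a = (1 / 2 : ℝ) • a := by module
    rw [Set.mem_preimage, this]
    exact h2

theorem intervalVolume_smul (h : IsSolidCone K) {r : ℝ} (hr : 0 < r) (a : E) :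
    intervalVolume K (r • a) = r ^ Module.finrank ℝ E * intervalVolume K a := by
  have hsmul : ∀ {x : E}, r • x ∈ K ↔ x ∈ K := fun {x} =>
    ⟨fun hx => by simpa [smul_smul, hr.ne'] using h.smul_mem _ hx r⁻¹ (by positivity),
      fun hx => h.smul_mem _ hx r hr.le⟩
  have hset : (fun x : E => r • x) ⁻¹' (K ∩ {x | r • a - x ∈ K}) = K ∩ {x | a - x ∈ K} := by
    ext x
    simp only [Set.mem_preimage, Set.mem_inter_iff, Set.mem_ofPred_eq, ← smul_sub, hsmul]
  unfold intervalVolume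
  rw [← hset, Measure.addHaar_preimage_smul _ hr.ne', ENNReal.toReal_mul,
    ENNReal.toReal_ofReal (by positivity), abs_of_pos (by positivity), ← mul_assoc,
    mul_inv_cancel₀ (by positivity), one_mul]

theorem intervalVolume_axialReflection (h : IsSolidCone K) (hφ : IsFlatFamily K φ)
    (hE : 2 ≤ Module.finrank ℝ E) {c : E} (hc : c ∈ interior K) (a : E) :
    intervalVolume K (axialReflection (φ c) c a) = intervalVolume K a := by
  have h2 := hφ.apply_self h hE hc
  have hmem : ∀ {x : E}, axialReflection (φ c) c x ∈ K ↔ x ∈ K := fun {x} =>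
    ⟨fun hx => by
      simpa [axialReflection_axialReflection h2] using hφ.axialReflection_mem h hE hc hx,
      fun hx => hφ.axialReflection_mem h hE hc hx⟩
  have hset : axialReflection (φ c) c ⁻¹' (K ∩ {x | axialReflection (φ c) c a - x ∈ K}) =
      K ∩ {x | a - x ∈ K} := by
    ext x
    simp only [Set.mem_preimage, Set.mem_inter_iff, Set.mem_ofPred_eq, ← map_sub, hmem]
  have hdet := abs_det_axialReflection h2
  unfold intervalVolume
  rw [← hset, Measure.addHaar_preimage_linearMap _ (fun h0 => by simp [h0] at hdet), abs_inv,
    hdet]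
  simp

/-- The power of the volume of the order interval that is homogeneous of degree `2`. -/
noncomputable def intervalForm (K : Set E) (a : E) : ℝ :=
  intervalVolume K a ^ (2 / Module.finrank ℝ E : ℝ)

theorem intervalForm_pos (h : IsSolidCone K) {a : E} (ha : a ∈ interior K) :
    0 < intervalForm K a :=
  Real.rpow_pos_of_pos (intervalVolume_pos h ha) _

/-- On the plane through two boundary points, the form is the product of the two coordinates, up
to a factor: a reflection of the plane, which swaps its two boundary rays, moves one of the two
points to a multiple of the other. -/
theorem intervalForm_combination (h : IsSolidCone K) (hφ : IsFlatFamily K φ)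
    (hE : 2 ≤ Module.finrank ℝ E) {p r : E} (hp : p ∈ frontier K) (hr : r ∈ frontier K)
    {α β γ δ : ℝ} (hα : 0 < α) (hβ : 0 < β) (hγ : 0 < γ) (hδ : 0 < δ)
    (ha : α • p + β • r ∈ interior K) (hb : γ • p + δ • r ∈ interior K) :
    γ * δ * intervalForm K (α • p + β • r) = α * β * intervalForm K (γ • p + δ • r) := by
  set a := α • p + β • r
  set b := γ • p + δ • r with hbdef
  obtain ⟨l, hl, hl2⟩ : ∃ l : ℝ, 0 < l ∧ l ^ 2 = α * β / (γ * δ) :=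
    ⟨√(α * β / (γ * δ)), Real.sqrt_pos.2 (by positivity), Real.sq_sqrt (by positivity)⟩
  -- this choice of `l` makes the reflection in `a + l • b` send `a` to `l • b`
  have hcdec : a + l • b = (α + l * γ) • p + (β + l * δ) • r := by module
  have hc : a + l • b ∈ interior K :=
    h.add_mem_interior ha (interior_subset (h.smul_mem_interior hb hl))
  have hcp : 0 < α + l * γ := by positivity
  have hcr : 0 < β + l * δ := by positivity
  obtain ⟨h1, h2⟩ := hφ.apply_combination h hp hr hcp hcr (hcdec ▸ hc)
  rw [← hcdec] at h1 h2
  have h3 : φ (a + l • b) a = 1 := by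
    have hl2' : l ^ 2 * (γ * δ) = α * β := by
      rw [hl2]; field_simp
    rw [map_add, map_smul, map_smul, h1, h2, smul_eq_mul, smul_eq_mul]
    field_simp
    linear_combination -hl2'
  have h4 := intervalVolume_axialReflection h hφ hE hc a
  rw [axialReflection_apply, h3, one_smul, add_sub_cancel_left, intervalVolume_smul h hl] at h4
  have hn : (0 : ℝ) < Module.finrank ℝ E := by exact_mod_cast (by omega : 0 < Module.finrank ℝ E)
  have h5 : intervalForm K a = l ^ 2 * intervalForm K b := by
    unfold intervalForm
    rw [← h4, Real.mul_rpow (by positivity) (intervalVolume_pos h hb).le, ← Real.rpow_natCast,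
      ← Real.rpow_mul hl.le, mul_div_cancel₀ _ hn.ne']
    norm_num
  rw [h5, hl2]
  field_simp

/-- Reciprocity: the flat functionals, weighted with the form, pair symmetrically. -/
theorem intervalForm_mul_symm (h : IsSolidCone K) (hφ : IsFlatFamily K φ)
    (hE : 2 ≤ Module.finrank ℝ E) {a b : E} (ha : a ∈ interior K) (hb : b ∈ interior K) :
    intervalForm K a * φ a b = intervalForm K b * φ b a := by
  obtain ⟨p, hp, r, hr, α, β, γ, δ, hα, hβ, hγ, hδ, rfl, rfl⟩ := h.exists_common_decomposition hE
    ha hb (hφ.ne_zero h hE ha) (hφ.ne_zero h hE hb)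
  obtain ⟨h1, h2⟩ := hφ.apply_combination h hp hr hα hβ ha
  obtain ⟨h3, h4⟩ := hφ.apply_combination h hp hr hγ hδ hb
  have h5 := intervalForm_combination h hφ hE hp hr hα hβ hγ hδ ha hb
  rw [map_add, map_smul, map_smul, h1, h2, map_add, map_smul, map_smul, h3, h4]
  simp only [smul_eq_mul]
  field_simp
  linear_combination (γ * β + δ * α) * h5

end Volume

/-! ### The invariant quadratic form -/

/-- A positive definite quadratic form is the square of a Euclidean norm in suitable
coordinates. -/
theorem QuadraticForm.exists_linearEquiv_euclideanSpace {M : Type*} [AddCommGroup M] [Module ℝ M]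
    [FiniteDimensional ℝ M] (Q : QuadraticForm ℝ M) (hQ : ∀ x, x ≠ 0 → 0 < Q x) :
    ∃ g : EuclideanSpace ℝ (Fin (Module.finrank ℝ M)) ≃ₗ[ℝ] M, ∀ y, Q (g y) = ‖y‖ ^ 2 := by
  obtain ⟨w, ⟨I⟩⟩ := Q.equivalent_signType_weighted_sum_squared
  have hI : ∀ y, Q (I.symm y) = ∑ i, (w i : ℝ) * (y i * y i) := by
    intro y
    rw [I.symm.map_app, QuadraticMap.weightedSumSquares_apply]
    simp
  have hw : ∀ i, (w i : ℝ) = 1 := by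
    intro i
    have h0 : I.symm (Pi.single i 1) ≠ 0 := by
      intro h0
      have h1 := (I.symm.toLinearEquiv.map_eq_zero_iff).1 h0
      simpa using congrFun h1 i
    have h1 := hQ _ h0
    rw [hI, Finset.sum_eq_single i (by intro j _ hj; simp [hj]) (by simp)] at h1
    simp only [Pi.single_eq_same, mul_one] at h1
    cases hi : w i <;> simp_all
    norm_num at h1
  refine ⟨(WithLp.linearEquiv 2 ℝ (Fin (Module.finrank ℝ M) → ℝ)).trans I.symm.toLinearEquiv,
    fun y => ?_⟩
  rw [EuclideanSpace.norm_sq_eq]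
  refine (hI _).trans (Finset.sum_congr rfl fun i _ => ?_)
  rw [hw i, one_mul, Real.norm_eq_abs, sq_abs, sq]
  rfl

section Form

variable {E : Type*} [NormedAddCommGroup E] [NormedSpace ℝ E] [FiniteDimensional ℝ E]
  [MeasurableSpace E] [BorelSpace E] {K : Set E} {φ : E → E →ₗ[ℝ] ℝ}

/-- By the symmetry of `intervalForm K a * φ a b`, the map `a ↦ intervalForm K a • φ a` on the
interior is the restriction of a symmetric bilinear form. -/
theorem exists_symm_bilinForm (h : IsSolidCone K) (hφ : IsFlatFamily K φ)
    (hE : 2 ≤ Module.finrank ℝ E) :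
    ∃ B : E →ₗ[ℝ] E →ₗ[ℝ] ℝ, (∀ x y, B x y = B y x) ∧
      ∀ a ∈ interior K, B a = intervalForm K a • φ a := by
  let b := Module.Basis.ofSpan h.span_interior.ge
  have hb : ∀ i, b i ∈ interior K := fun i =>
    Module.Basis.ofSpan_subset h.span_interior.ge ⟨i, rfl⟩
  let B : E →ₗ[ℝ] E →ₗ[ℝ] ℝ := b.constr ℝ fun i => intervalForm K (b i) • φ (b i)
  have hB : ∀ i, B (b i) = intervalForm K (b i) • φ (b i) := fun i => b.constr_basis ℝ _ i
  have hsymm : ∀ i j, B (b i) (b j) = B (b j) (b i) := by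
    intro i j
    simp only [hB, LinearMap.smul_apply, smul_eq_mul]
    exact intervalForm_mul_symm h hφ hE (hb i) (hb j)
  have hflip : B.flip = B := b.ext fun i => b.ext fun j => hsymm j i
  refine ⟨B, fun x y => ?_, fun a ha => b.ext fun j => ?_⟩
  · conv_lhs => rw [← hflip]
    rfl
  · have h1 : B a (b j) = B (b j) a := by
      conv_lhs => rw [← hflip]
      rfl
    rw [h1, hB]
    simp only [LinearMap.smul_apply, smul_eq_mul]
    exact intervalForm_mul_symm h hφ hE (hb j) ha

/-- The extended form vanishes on the boundary of the cone. -/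
theorem bilinForm_self_of_mem_frontier (h : IsSolidCone K) (hφ : IsFlatFamily K φ)
    (hE : 2 ≤ Module.finrank ℝ E) {B : E →ₗ[ℝ] E →ₗ[ℝ] ℝ}
    (hB : ∀ a ∈ interior K, B a = intervalForm K a • φ a) {v : E} (hv : v ∈ frontier K) :
    B v v = 0 := by
  by_cases hv0 : v = 0
  · simp [hv0]
  obtain ⟨e, he⟩ := h.interior_nonempty
  obtain ⟨s, hs, hr⟩ := h.exists_sub_smul_mem_frontier he (h.mem_of_mem_frontier hv) hv0
  set r := e - s • v with hrdef
  -- compare `B (s • v + r) v` with `B ((2 * s) • v + r) v`, which are both known from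
  -- `intervalForm_combination`
  have h1 : s • v + (1 : ℝ) • r ∈ interior K := by
    rw [one_smul, hrdef, add_sub_cancel]; exact he
  have h2 : (2 * s) • v + (1 : ℝ) • r ∈ interior K := by
    have := h.add_mem_interior h1 (h.smul_mem v (h.mem_of_mem_frontier hv) s hs.le)
    convert this using 1
    module
  have h3 := (hφ.apply_combination h hv hr hs one_pos h1).1
  have h4 := (hφ.apply_combination h hv hr (by positivity) one_pos h2).1
  have h5 := intervalForm_combination h hφ hE hv hr hs one_pos (by positivity) one_pos h1 h2
  have h6 := LinearMap.congr_fun (hB _ h1) v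
  have h7 := LinearMap.congr_fun (hB _ h2) v
  simp only [map_add, map_smul, LinearMap.add_apply, LinearMap.smul_apply, smul_eq_mul, h3, h4,
    one_mul, mul_one] at h5 h6 h7
  generalize intervalForm K (s • v + (1 : ℝ) • r) = q₁ at h5 h6
  generalize intervalForm K ((2 * s) • v + (1 : ℝ) • r) = q₂ at h5 h7
  have h8 : q₂ = 2 * q₁ := mul_left_cancel₀ hs.ne' (by linear_combination -h5)
  rw [h8] at h7
  field_simp at h6 h7
  have h9 : s * s * B v v = 0 := by linear_combination h7 - h6
  simpa [hs.ne'] using h9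

/-- A solid cone with a flat family has a section that is an ellipsoid of full dimension. -/
theorem IsFlatFamily.exists_ellipsoidal_section (h : IsSolidCone K) (hφ : IsFlatFamily K φ)
    (hE : 2 ≤ Module.finrank ℝ E) :
    ∃ (m : ℕ) (χ : E →ₗ[ℝ] ℝ) (e : E) (g : EuclideanSpace ℝ (Fin m) →ₗ[ℝ] E),
      χ e = 1 ∧ Function.Injective g ∧ LinearMap.range g = LinearMap.ker χ ∧
      K ∩ {x | χ x = 1} = (fun y => e + g y) '' Metric.closedBall 0 1 := by
  obtain ⟨B, hsymm, hB⟩ := exists_symm_bilinForm h hφ hE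
  obtain ⟨e, he⟩ := h.interior_nonempty
  have hee : φ e e = 2 := hφ.apply_self h hE he
  have hq := intervalForm_pos h he
  have hBe : ∀ x, B e x = intervalForm K e * φ e x := fun x => LinearMap.congr_fun (hB e he) x
  have hBee : 0 < B e e := by rw [hBe, hee]; positivity
  -- lines through `e` in `ker (φ e)` leave the cone where the form vanishes
  have hexit : ∀ x, φ e x = 0 → x ≠ 0 → ∃ s : ℝ, 0 < s ∧ e + s • x ∈ frontier K ∧
      s ^ 2 * B x x = - B e e := by
    intro x hx hx0
    have hxK : x ∉ K := fun hxK => (hφ.pos h hE he hxK hx0).ne' hx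
    obtain ⟨s, hs, hf⟩ := h.exists_add_smul_mem_frontier he hxK
    refine ⟨s, hs, hf, ?_⟩
    have h1 := bilinForm_self_of_mem_frontier h hφ hE hB hf
    have h2 : B e x = 0 := by rw [hBe, hx, mul_zero]
    have h3 : B x e = 0 := by rw [hsymm, h2]
    simp only [map_add, map_smul, LinearMap.add_apply, LinearMap.smul_apply, smul_eq_mul, h2,
      h3] at h1
    linear_combination h1
  have hneg : ∀ x, φ e x = 0 → x ≠ 0 → B x x < 0 := by
    intro x hx hx0
    obtain ⟨s, hs, -, h1⟩ := hexit x hx hx0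
    have : 0 < s ^ 2 := by positivity
    nlinarith
  have hmem : ∀ x, φ e x = 0 → (e + x ∈ K ↔ - B x x ≤ B e e) := by
    intro x hx
    by_cases hx0 : x = 0
    · simp only [hx0, add_zero, map_zero, neg_zero, hBee.le, iff_true]
      exact interior_subset he
    obtain ⟨s, hs, hf, h1⟩ := hexit x hx hx0
    have hn := hneg x hx hx0
    have hs1 : e + x ∈ K ↔ 1 ≤ s := by
      constructor
      · intro hK
        by_contra! hlt
        apply (h.mem_frontier_iff.1 hf).2
        have := h.add_mem_interior (h.smul_mem_interior he (sub_pos.2 hlt))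
          (h.smul_mem _ hK s hs.le)
        convert this using 1
        module
      · intro hle
        have hs' : s⁻¹ ≤ 1 := inv_le_one_of_one_le₀ hle
        have := h.convex (h.mem_of_mem_frontier hf) (interior_subset he)
          (inv_nonneg.2 hs.le) (sub_nonneg.2 hs') (by ring)
        convert this using 1
        match_scalars <;> field_simp
        ring
    rw [hs1]
    constructor
    · intro hle
      nlinarith [mul_nonneg (sub_nonneg.2 hle) (neg_nonneg.2 hn.le)]
    · intro hle
      by_contra! hlt
      nlinarith [mul_pos (sub_pos.2 hlt) (neg_pos.2 hn)]
  let N := LinearMap.ker (φ e)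
  let P : QuadraticForm ℝ N :=
    (LinearMap.BilinMap.toQuadraticMap ((-(B e e)⁻¹) • B)).comp N.subtype
  have hP : ∀ x : N, P x = -(B e e)⁻¹ * B (x : E) (x : E) := fun x => rfl
  obtain ⟨g, hg⟩ := QuadraticForm.exists_linearEquiv_euclideanSpace P (by
    intro x hx0
    have := hneg x x.2 (by simpa using hx0)
    rw [hP, neg_mul, ← mul_neg]
    exact mul_pos (inv_pos.2 hBee) (neg_pos.2 this))
  have hker : ∀ x, ((1 / 2 : ℝ) • φ e) x = 0 ↔ φ e x = 0 := by
    intro x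
    simp
  have hball : ∀ y, ‖y‖ ≤ 1 ↔ e + (g y : E) ∈ K := by
    intro y
    rw [hmem _ (g y).2, ← sq_le_one_iff₀ (norm_nonneg y), ← hg, hP, neg_mul, ← mul_neg,
      inv_mul_le_iff₀ hBee, mul_one]
  refine ⟨_, (1 / 2 : ℝ) • φ e, e, N.subtype ∘ₗ g.toLinearMap, by simp [hee],
    N.injective_subtype.comp g.injective, ?_, ?_⟩
  · rw [LinearMap.range_comp, LinearEquiv.range, Submodule.map_top, Submodule.range_subtype]
    ext x
    exact (hker x).symm
  · ext x
    simp only [Set.mem_inter_iff, Set.mem_ofPred_eq, Set.mem_image, mem_closedBall_zero_iff]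
    constructor
    · rintro ⟨hx, hx1⟩
      have hxe : φ e (x - e) = 0 := by
        have : φ e x = 2 := by simp at hx1; linarith
        rw [map_sub, this, hee, sub_self]
      refine ⟨g.symm ⟨x - e, hxe⟩, ?_, ?_⟩
      · rw [hball]
        simpa using hx
      · simp
    · rintro ⟨y, hy, rfl⟩
      refine ⟨(hball y).1 hy, ?_⟩
      have : φ e (g y : E) = 0 := (g y).2
      simp [hee, this]

end Form

/-- If every set `∂K ∩ ∂(a - K)` spans a proper affine subspace, the cone has a flat family. -/
theorem IsSolidCone.exists_isFlatFamily {E : Type*} [NormedAddCommGroup E] [NormedSpace ℝ E]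
    [FiniteDimensional ℝ E] {K : Set E} (h : IsSolidCone K) (hE : 2 ≤ Module.finrank ℝ E)
    (hK : ∀ a ∈ interior K, Module.finrank ℝ
      (affineSpan ℝ (frontier K ∩ {x | a - x ∈ frontier K})).direction < Module.finrank ℝ E) :
    ∃ φ : E → E →ₗ[ℝ] ℝ, IsFlatFamily K φ := by
  have key : ∀ a ∈ interior K, ∃ f : E →ₗ[ℝ] ℝ,
      ∀ x ∈ frontier K, a - x ∈ frontier K → f x = 1 := by
    intro a ha
    set A := affineSpan ℝ (frontier K ∩ {x | a - x ∈ frontier K})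
    have hsub : ∀ x ∈ frontier K, a - x ∈ frontier K → x ∈ A := fun x h1 h2 =>
      subset_affineSpan ℝ _ ⟨h1, h2⟩
    obtain ⟨p, hp, hr, hp0⟩ := h.exists_mem_frontier_sub_mem hE ha
    have hpA := hsub p hp hr
    have h0 : p ∉ A.direction := by
      intro hpd
      -- then `A` is a linear subspace that meets every boundary ray, hence is everything
      have hle : frontier K ⊆ A.direction := by
        intro v hv
        by_cases hv0 : v = 0
        · simp [hv0]
        obtain ⟨s, hs, hf⟩ := h.exists_sub_smul_mem_frontier ha (h.mem_of_mem_frontier hv) hv0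
        have h1 := AffineSubspace.vsub_mem_direction
          (hsub _ (h.smul_mem_frontier hv hs) hf) hpA
        have h2 := A.direction.add_mem h1 hpd
        rw [vsub_eq_sub, sub_add_cancel] at h2
        simpa [smul_smul, hs.ne'] using A.direction.smul_mem s⁻¹ h2
      have htop : A.direction = ⊤ := by
        rw [← top_le_iff, ← h.span_frontier hE, Submodule.span_le]
        exact hle
      have := hK a ha
      rw [htop, finrank_top] at this
      exact lt_irrefl _ this
    obtain ⟨f, hfp, hf⟩ := Submodule.exists_le_ker_of_notMem h0
    refine ⟨(f p)⁻¹ • f, fun x h1 h2 => ?_⟩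
    have h3 : f (x - p) = 0 := hf (AffineSubspace.vsub_mem_direction (hsub x h1 h2) hpA)
    rw [map_sub, sub_eq_zero] at h3
    rw [LinearMap.smul_apply, smul_eq_mul, h3, inv_mul_cancel₀ hfp]
  choose! φ hφ using key
  exact ⟨φ, hφ⟩

/-! ### Invariance under injective linear maps -/

namespace FBI

section Transfer

variable {E V : Type*} [AddCommGroup E] [Module ℝ E] [AddCommGroup V] [Module ℝ V]

theorem setDim_image (g : E →ₗ[ℝ] V) (hg : Function.Injective g) (S : Set E) :
    setDim (g '' S) = setDim S := by
  unfold setDim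
  by_cases hS : S = ∅
  · simp [hS]
  rw [if_neg hS, if_neg (by simpa using hS)]
  have h1 : affineSpan ℝ (g '' S) = (affineSpan ℝ S).map g.toAffineMap := by
    rw [AffineSubspace.map_span]; rfl
  rw [h1, AffineSubspace.map_direction, LinearMap.toAffineMap_linear,
    ← (Submodule.equivMapOfInjective g hg _).finrank_eq]

theorem setDim_of_affineSpan_eq_top {S : Set E} (hS : affineSpan ℝ S = ⊤) :
    setDim S = Module.finrank ℝ E := by
  unfold setDim
  have hne : S ≠ ∅ := by
    rintro rfl
    simp at hS
  rw [if_neg hne, hS, AffineSubspace.direction_top, finrank_top]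

variable [TopologicalSpace E] [IsTopologicalAddGroup E] [ContinuousSMul ℝ E] [T2Space E]
  [FiniteDimensional ℝ E]
  [TopologicalSpace V] [IsTopologicalAddGroup V] [ContinuousSMul ℝ V] [T2Space V]

/-- A subset that affinely spans the domain of an injective linear map acquires, in the affine
span of its image, the topology of the domain. -/
theorem exists_homeomorph_affineSpan_image (g : E →ₗ[ℝ] V) (hg : Function.Injective g) {S : Set E}
    (hS : affineSpan ℝ S = ⊤) :
    ∃ k : E ≃ₜ affineSpan ℝ (g '' S), ∀ x, (k x : V) = g x := by
  have hrange : ∀ y : V, y ∈ affineSpan ℝ (g '' S) ↔ ∃ x, g x = y := by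
    intro y
    have h1 : affineSpan ℝ (g '' S) = (affineSpan ℝ S).map g.toAffineMap := by
      rw [AffineSubspace.map_span]; rfl
    rw [h1, hS, AffineSubspace.mem_map]
    simp
  have hemb : Topology.IsEmbedding (fun x : E =>
      (⟨g x, (hrange _).2 ⟨x, rfl⟩⟩ : affineSpan ℝ (g '' S))) :=
    (LinearMap.isClosedEmbedding_of_injective (LinearMap.ker_eq_bot.2 hg)).isEmbedding.codRestrict
      (affineSpan ℝ (g '' S) : Set V) fun x => (hrange _).2 ⟨x, rfl⟩
  have hsurj : Function.Surjective (fun x : E =>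
      (⟨g x, (hrange _).2 ⟨x, rfl⟩⟩ : affineSpan ℝ (g '' S))) := by
    rintro ⟨y, hy⟩
    obtain ⟨x, rfl⟩ := (hrange y).1 hy
    exact ⟨x, rfl⟩
  exact ⟨hemb.toHomeomorphOfSurjective hsurj, fun x => rfl⟩

theorem intrinsicInterior_image (g : E →ₗ[ℝ] V) (hg : Function.Injective g) {S : Set E}
    (hS : affineSpan ℝ S = ⊤) : intrinsicInterior ℝ (g '' S) = g '' interior S := by
  obtain ⟨k, hk⟩ := exists_homeomorph_affineSpan_image g hg hS
  have h1 : ((↑) ⁻¹' (g '' S) : Set (affineSpan ℝ (g '' S))) = k '' S := by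
    ext y
    obtain ⟨x, rfl⟩ := k.surjective y
    simp [hk, hg.mem_set_image]
  rw [intrinsicInterior, h1, ← k.image_interior, Set.image_image]
  simp only [hk]

theorem intrinsicFrontier_image (g : E →ₗ[ℝ] V) (hg : Function.Injective g) {S : Set E}
    (hS : affineSpan ℝ S = ⊤) : intrinsicFrontier ℝ (g '' S) = g '' frontier S := by
  obtain ⟨k, hk⟩ := exists_homeomorph_affineSpan_image g hg hS
  have h1 : ((↑) ⁻¹' (g '' S) : Set (affineSpan ℝ (g '' S))) = k '' S := by
    ext y
    obtain ⟨x, rfl⟩ := k.surjective y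
    simp [hk, hg.mem_set_image]
  rw [intrinsicFrontier, h1, ← k.image_frontier, Set.image_image]
  simp only [hk]

end Transfer

/-- The flat boundary intersections property of a cone that is the injective linear image of a
cone with nonempty interior. -/
theorem hasFBI_image_iff {E V : Type*} [NormedAddCommGroup E] [NormedSpace ℝ E]
    [FiniteDimensional ℝ E] [AddCommGroup V] [Module ℝ V]
    [TopologicalSpace V] [IsTopologicalAddGroup V] [ContinuousSMul ℝ V] [T2Space V]
    (g : E →ₗ[ℝ] V) (hg : Function.Injective g) {K : Set E}
    (hK : (interior K).Nonempty) :
    HasFBI (g '' K) ↔ ∀ a ∈ interior K,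
      setDim (frontier K ∩ {x | a - x ∈ frontier K}) = Module.finrank ℝ E - 1 := by
  have htop := affineSpan_eq_top_of_nonempty_interior
    (hK.mono (interior_mono (subset_convexHull ℝ K)))
  have key : ∀ a : E, intrinsicFrontier ℝ (g '' K) ∩
      intrinsicFrontier ℝ ((fun x : V => g a - x) '' (g '' K)) =
      g '' (frontier K ∩ {x | a - x ∈ frontier K}) := by
    intro a
    have h1 : (fun x : V => g a - x) '' (g '' K) = g '' (Homeomorph.subLeft a '' K) := by
      simp only [Set.image_image, Homeomorph.coe_subLeft, map_sub]
    have h2 : affineSpan ℝ (Homeomorph.subLeft a '' K) = ⊤ := by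
      obtain ⟨x, hx⟩ := hK
      exact affineSpan_eq_top_of_nonempty_interior (s := Homeomorph.subLeft a '' K)
        ⟨a - x, interior_mono (subset_convexHull ℝ _)
          ((Homeomorph.subLeft a).image_interior K ▸ ⟨x, hx, rfl⟩)⟩
    rw [h1, intrinsicFrontier_image g hg htop, intrinsicFrontier_image g hg h2,
      ← Homeomorph.image_frontier, ← Set.image_inter hg]
    congr 2
    ext x
    simp only [Set.mem_image, Homeomorph.coe_subLeft, Set.mem_ofPred_eq]
    constructor
    · rintro ⟨y, hy, rfl⟩
      simpa using hy
    · exact fun hx => ⟨_, hx, by simp⟩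
  unfold HasFBI
  rw [intrinsicInterior_image g hg htop, Set.forall_mem_image]
  simp only [key, setDim_image g hg, setDim_of_affineSpan_eq_top htop]

end FBI

/-! ### Cones over balls -/

namespace FBI

/-- A spanning subset of an affine hyperplane off the origin affinely spans that hyperplane. -/
theorem direction_affineSpan_eq_ker {E : Type*} [AddCommGroup E] [Module ℝ E] {M : Set E}
    (χ : E →ₗ[ℝ] ℝ) {κ : ℝ} (hκ : κ ≠ 0) (hM : ∀ x ∈ M, χ x = κ) (hne : M.Nonempty)
    (hspan : Submodule.span ℝ M = ⊤) : (affineSpan ℝ M).direction = LinearMap.ker χ := by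
  rw [direction_affineSpan]
  apply le_antisymm
  · rw [vectorSpan_def, Submodule.span_le]
    rintro _ ⟨x, hx, y, hy, rfl⟩
    simp [hM x hx, hM y hy]
  · obtain ⟨m, hm⟩ := hne
    intro x hx
    have h1 : Submodule.span ℝ M ≤ vectorSpan ℝ M ⊔ Submodule.span ℝ {m} := by
      rw [Submodule.span_le]
      intro y hy
      have := Submodule.add_mem_sup (vsub_mem_vectorSpan ℝ hy hm)
        (Submodule.mem_span_singleton_self (R := ℝ) m)
      simpa using this
    have h2 : x ∈ vectorSpan ℝ M ⊔ Submodule.span ℝ {m} := h1 (hspan ▸ Submodule.mem_top)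
    obtain ⟨d, hd, z, hz, rfl⟩ := Submodule.mem_sup.1 h2
    obtain ⟨c, rfl⟩ := Submodule.mem_span_singleton.1 hz
    have h3 : vectorSpan ℝ M ≤ LinearMap.ker χ := by
      rw [vectorSpan_def, Submodule.span_le]
      rintro _ ⟨x, hx, y, hy, rfl⟩
      simp [hM x hx, hM y hy]
    have h4 : χ d = 0 := h3 hd
    have h5 : χ (d + c • m) = 0 := hx
    rw [map_add, h4, map_smul, hM m hm, zero_add, smul_eq_mul] at h5
    have h6 : c = 0 := by simpa [hκ] using h5
    simpa [h6] using hd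

section Lorentz

variable {F : Type*} [NormedAddCommGroup F] [InnerProductSpace ℝ F]

/-- The cone over the closed unit ball. -/
def ballCone (F : Type*) [NormedAddCommGroup F] : Set (ℝ × F) := {p | ‖p.2‖ ≤ p.1}

theorem interior_ballCone : interior (ballCone F) = {p | ‖p.2‖ < p.1} := by
  apply subset_antisymm
  · intro p hp
    have hc : Filter.Tendsto (fun s : ℝ => p - s • ((1 : ℝ), (0 : F))) (nhds 0) (nhds p) := by
      have : Continuous fun s : ℝ => p - s • ((1 : ℝ), (0 : F)) := by fun_prop
      simpa using this.tendsto 0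
    have h1 := hc.eventually (isOpen_interior.mem_nhds hp)
    obtain ⟨s, hs, hs0⟩ := ((h1.filter_mono nhdsWithin_le_nhds).and
      (self_mem_nhdsWithin : Set.Ioi (0 : ℝ) ∈ nhdsWithin 0 (Set.Ioi 0))).exists
    have h2 : ‖p.2‖ ≤ p.1 - s := by
      simpa [ballCone] using interior_subset hs
    have h3 : 0 < s := hs0
    show ‖p.2‖ < p.1
    linarith
  · exact interior_maximal (fun p (hp : ‖p.2‖ < p.1) => show ‖p.2‖ ≤ p.1 from hp.le)
      (isOpen_lt (by fun_prop) (by fun_prop))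

theorem frontier_ballCone : frontier (ballCone F) = {p | ‖p.2‖ = p.1} := by
  have hcl : IsClosed (ballCone F) := isClosed_le (by fun_prop) (by fun_prop)
  rw [hcl.frontier_eq, interior_ballCone]
  ext p
  simp only [ballCone, Set.mem_sdiff, Set.mem_ofPred_eq, not_lt]
  exact ⟨fun h => le_antisymm h.1 h.2, fun h => ⟨h.le, h.ge⟩⟩

theorem span_frontier_ballCone [Nontrivial F] :
    Submodule.span ℝ {p : ℝ × F | ‖p.2‖ = p.1} = ⊤ := by
  set W := Submodule.span ℝ {p : ℝ × F | ‖p.2‖ = p.1}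
  have hmem : ∀ y : F, (‖y‖, y) ∈ W := fun y => Submodule.subset_span rfl
  have h1 : ((1 : ℝ), (0 : F)) ∈ W := by
    obtain ⟨u, hu⟩ := exists_ne (0 : F)
    have h2 := W.smul_mem (2 * ‖u‖)⁻¹ (W.add_mem (hmem u) (hmem (-u)))
    have h3 : ‖u‖ ≠ 0 := norm_ne_zero_iff.2 hu
    convert h2 using 1
    ext
    · simp only [norm_neg, Prod.mk_add_mk, Prod.smul_mk, smul_eq_mul]
      field_simp
      norm_num
    · simp
  rw [Submodule.eq_top_iff']
  rintro ⟨t, y⟩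
  have := W.add_mem (hmem y) (W.smul_mem (t - ‖y‖) h1)
  convert this using 1
  ext <;> simp

/-- In the cone over a ball, `∂K ∩ ∂(a - K)` is the section of the boundary by a hyperplane, the
polar of `a` with respect to the Lorentz form. -/
theorem setDim_frontier_inter_ballCone [FiniteDimensional ℝ F] [Nontrivial F] {a : ℝ × F}
    (ha : a ∈ interior (ballCone F)) :
    setDim (frontier (ballCone F) ∩ {x | a - x ∈ frontier (ballCone F)}) =
      Module.finrank ℝ (ℝ × F) - 1 := by
  rw [interior_ballCone] at ha
  have ha' : ‖a.2‖ < a.1 := ha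
  have ha1 : 0 < a.1 := (norm_nonneg _).trans_lt ha'
  let χ : ℝ × F →ₗ[ℝ] ℝ := a.1 • LinearMap.fst ℝ ℝ F - (innerₗ F a.2) ∘ₗ LinearMap.snd ℝ ℝ F
  have hχ : ∀ p : ℝ × F, χ p = a.1 * p.1 - inner ℝ a.2 p.2 := fun p => rfl
  set κ : ℝ := (a.1 ^ 2 - ‖a.2‖ ^ 2) / 2 with hκdef
  have hκ : 0 < κ := by
    have : 0 < (a.1 - ‖a.2‖) * (a.1 + ‖a.2‖) := by
      have := norm_nonneg a.2
      exact mul_pos (by linarith) (by linarith)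
    rw [hκdef]
    nlinarith
  have hpos : ∀ p : ℝ × F, ‖p.2‖ = p.1 → p ≠ 0 → 0 < χ p := by
    intro p hp hp0
    have h1 : 0 < p.1 := by
      rw [← hp, norm_pos_iff]
      intro h0
      apply hp0
      ext
      · simp [← hp, h0]
      · exact h0
    have h2 := real_inner_le_norm a.2 p.2
    rw [hχ]
    rw [hp] at h2
    nlinarith
  have hiff : ∀ x, x ∈ frontier (ballCone F) ∩ {x | a - x ∈ frontier (ballCone F)} ↔
      ‖x.2‖ = x.1 ∧ χ x = κ := by
    intro x
    rw [frontier_ballCone]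
    simp only [Set.mem_inter_iff, Set.mem_ofPred_eq, Prod.snd_sub, Prod.fst_sub]
    refine and_congr_right fun hx => ?_
    have h1 := norm_sub_sq_real a.2 x.2
    rw [hx] at h1
    rw [hχ, hκdef]
    constructor
    · intro h2
      rw [h2] at h1
      linarith
    · intro h2
      have h3 : ‖a.2 - x.2‖ ^ 2 = (a.1 - x.1) ^ 2 := by rw [h1]; linarith
      -- otherwise `a - x` is in the opposite cone, where Cauchy-Schwarz makes `χ` negative,
      -- while `χ (a - x) = 2 * κ - κ`
      have h4 : 0 ≤ a.1 - x.1 := by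
        by_contra! hlt
        have h5 : ‖a.2 - x.2‖ = -(a.1 - x.1) := by
          rw [← sq_eq_sq₀ (norm_nonneg _) (by linarith), h3, neg_sq]
        have h7 := abs_le.1 (abs_real_inner_le_norm a.2 (a.2 - x.2))
        rw [inner_sub_right, real_inner_self_eq_norm_sq, h5] at h7
        nlinarith [h7.1, mul_pos (sub_pos.2 ha') (neg_pos.2 hlt)]
      rw [← sq_eq_sq₀ (norm_nonneg _) h4, h3]
  set M := frontier (ballCone F) ∩ {x | a - x ∈ frontier (ballCone F)}
  have hscale : ∀ p : ℝ × F, ‖p.2‖ = p.1 → p ≠ 0 → (κ / χ p) • p ∈ M := by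
    intro p hp hp0
    have h1 := hpos p hp hp0
    rw [hiff]
    refine ⟨?_, ?_⟩
    · rw [Prod.smul_snd, Prod.smul_fst, norm_smul, hp, Real.norm_eq_abs,
        abs_of_pos (by positivity), smul_eq_mul]
    · rw [map_smul, smul_eq_mul, div_mul_cancel₀ _ h1.ne']
  have hspan : Submodule.span ℝ M = ⊤ := by
    rw [← top_le_iff, ← span_frontier_ballCone, Submodule.span_le]
    intro p hp
    by_cases hp0 : p = 0
    · simp [hp0]
    have h1 := hpos p hp hp0
    have := Submodule.smul_mem _ (χ p / κ) (Submodule.subset_span (R := ℝ) (hscale p hp hp0))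
    rw [smul_smul, div_mul_div_cancel₀ hκ.ne', div_self h1.ne', one_smul] at this
    exact this
  have hne : M.Nonempty := by
    obtain ⟨u, hu⟩ := exists_ne (0 : F)
    exact ⟨_, hscale (‖u‖, u) rfl (by simp [hu])⟩
  have hχ0 : χ ≠ 0 := by
    rintro h0
    obtain ⟨x, hx⟩ := hne
    have := ((hiff x).1 hx).2
    simp [h0] at this
    exact hκ.ne this
  have hfin := Module.Dual.finrank_ker_add_one_of_ne_zero (f := χ) hχ0
  unfold setDim
  rw [if_neg hne.ne_empty,
    direction_affineSpan_eq_ker χ hκ.ne' (fun x hx => ((hiff x).1 hx).2) hne hspan]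
  omega

end Lorentz

end FBI

/-! ### Cones in a vector space -/

namespace FBI

theorem IsClosedPointedCone.add_mem {V : Type*} [AddCommGroup V] [Module ℝ V]
    [TopologicalSpace V] {C : Set V} (hC : IsClosedPointedCone C) {x y : V} (hx : x ∈ C)
    (hy : y ∈ C) : x + y ∈ C := by
  have := hC.smul_mem _ (hC.convex hx hy (a := 1 / 2) (b := 1 / 2) (by norm_num) (by norm_num)
    (by norm_num)) 2 (by norm_num)
  simpa [smul_add, smul_smul] using this

/-- In dimension at least `2`, the cone lies on one side of the hyperplane that meets it in `0`. -/
theorem IsClosedPointedCone.exists_pos {V : Type*} [AddCommGroup V] [Module ℝ V]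
    [FiniteDimensional ℝ V] [TopologicalSpace V] {C : Set V} (hC : IsClosedPointedCone C)
    (hdim : 2 ≤ setDim C) : ∃ ψ : V →ₗ[ℝ] ℝ, ∀ x ∈ C, x ≠ 0 → 0 < ψ x := by
  obtain ⟨H, hH, hHC⟩ := hC.pointed
  obtain ⟨v, hv⟩ : ∃ v, v ∉ H := by
    by_contra! hall
    rw [Submodule.eq_top_iff'.2 hall, finrank_top] at hH
    omega
  obtain ⟨f, hfv, hf⟩ := Submodule.exists_le_ker_of_notMem hv
  have hker : H = LinearMap.ker f := by
    have := Module.Dual.finrank_ker_add_one_of_ne_zero (f := f) (fun h0 => hfv (by simp [h0]))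
    exact Submodule.eq_of_le_of_finrank_eq hf (by omega)
  have h0 : ∀ x ∈ C, f x = 0 → x = 0 := by
    intro x hx hfx
    have h1 : x ∈ (H : Set V) ∩ C := ⟨by rw [hker]; exact hfx, hx⟩
    rwa [hHC] at h1
  have hpair : ∀ x ∈ C, ∀ y ∈ C, 0 < f x → f y < 0 → (-f y) • x + f x • y = 0 := by
    intro x hx y hy h1 h2
    refine h0 _ (hC.add_mem (hC.smul_mem x hx _ (by linarith)) (hC.smul_mem y hy _ h1.le)) ?_
    simp only [map_add, map_smul, smul_eq_mul]
    ring
  by_cases hpos : ∃ x ∈ C, 0 < f x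
  · by_cases hneg : ∃ y ∈ C, f y < 0
    · -- points on both sides of the hyperplane force the cone into a line
      exfalso
      obtain ⟨x, hx, hfx⟩ := hpos
      obtain ⟨y, hy, hfy⟩ := hneg
      have hline : ∀ z ∈ C, f z < 0 → z ∈ Submodule.span ℝ {x} := by
        intro z hz hfz
        have h1 := hpair x hx z hz hfx hfz
        rw [Submodule.mem_span_singleton]
        refine ⟨(f x)⁻¹ * f z, ?_⟩
        have h2 : f x • z = f z • x := by
          rw [← sub_eq_zero, ← h1]; module
        rw [mul_smul, ← h2, smul_smul, inv_mul_cancel₀ hfx.ne', one_smul]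
      have hsub : C ⊆ Submodule.span ℝ {x} := by
        intro z hz
        rcases lt_trichotomy (f z) 0 with h1 | h1 | h1
        · exact hline z hz h1
        · rw [h0 z hz h1]; exact Submodule.zero_mem _
        · have h2 := hpair z hz y hy h1 hfy
          have h3 : z = (-f y)⁻¹ • ((-f z) • y) := by
            have h4 : (-f y) • z = (-f z) • y := by
              rw [← sub_eq_zero, ← h2]; module
            rw [← h4, smul_smul, inv_mul_cancel₀ (by linarith), one_smul]
          rw [h3]
          exact Submodule.smul_mem _ _ (Submodule.smul_mem _ _ (hline y hy hfy))
      have h1 : (affineSpan ℝ C).direction ≤ Submodule.span ℝ {x} := by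
        rw [direction_affineSpan, vectorSpan_def, Submodule.span_le]
        rintro _ ⟨z, hz, w, hw, rfl⟩
        exact Submodule.sub_mem _ (hsub hz) (hsub hw)
      have h2 := Submodule.finrank_mono h1
      have h3 := finrank_span_le_card (R := ℝ) ({x} : Set V)
      simp only [Set.toFinset_singleton, Finset.card_singleton] at h3
      unfold setDim at hdim
      rw [if_neg hC.nonempty.ne_empty] at hdim
      omega
    · push Not at hneg
      exact ⟨f, fun x hx hx0 => lt_of_le_of_ne (hneg x hx) fun h => hx0 (h0 x hx h.symm)⟩
  · push Not at hpos
    refine ⟨-f, fun x hx hx0 => ?_⟩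
    have := lt_of_le_of_ne (hpos x hx) fun h => hx0 (h0 x hx h)
    simpa using this

/-- A closed pointed cone is the injective linear image of a solid cone in a Euclidean space. -/
theorem IsClosedPointedCone.exists_isSolidCone {V : Type*} [AddCommGroup V] [Module ℝ V]
    [FiniteDimensional ℝ V] [TopologicalSpace V] [IsTopologicalAddGroup V] [ContinuousSMul ℝ V]
    [T2Space V] {C : Set V} (hC : IsClosedPointedCone C) (hdim : 2 ≤ setDim C) :
    ∃ (n : ℕ) (g : EuclideanSpace ℝ (Fin n) →ₗ[ℝ] V) (K : Set (EuclideanSpace ℝ (Fin n))),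
      Function.Injective g ∧ C = g '' K ∧ IsSolidCone K := by
  obtain ⟨ψ, hψ⟩ := hC.exists_pos hdim
  set W := Submodule.span ℝ C
  let e : EuclideanSpace ℝ (Fin (Module.finrank ℝ W)) ≃ₗ[ℝ] W :=
    LinearEquiv.ofFinrankEq _ _ (by simp)
  let g := W.subtype ∘ₗ e.toLinearMap
  have hg : Function.Injective g := W.injective_subtype.comp e.injective
  have hrange : ∀ x ∈ C, ∃ y, g y = x := fun x hx =>
    ⟨e.symm ⟨x, Submodule.subset_span hx⟩, by simp [g]⟩
  have himage : C = g '' (g ⁻¹' C) := by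
    rw [Set.image_preimage_eq_of_subset]
    exact fun x hx => hrange x hx
  have hconv : Convex ℝ (g ⁻¹' C) := hC.convex.linear_preimage g
  refine ⟨_, g, g ⁻¹' C, hg, himage, hconv, ?_, ?_, ?_, ψ ∘ₗ g, ?_⟩
  · intro x hx r hr
    rw [Set.mem_preimage, map_smul]
    exact hC.smul_mem _ hx r hr
  · exact hC.isClosed.preimage g.continuous_of_finiteDimensional
  · rw [hconv.interior_nonempty_iff_affineSpan_eq_top]
    have h0 : (0 : EuclideanSpace ℝ (Fin (Module.finrank ℝ W))) ∈ g ⁻¹' C := by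
      obtain ⟨x, hx⟩ := hC.nonempty
      simpa using hC.smul_mem x hx 0 le_rfl
    have h1 : Submodule.span ℝ (g ⁻¹' C) = ⊤ := by
      apply Submodule.map_injective_of_injective hg
      rw [Submodule.map_span, ← himage, Submodule.map_top, LinearMap.range_comp,
        LinearEquiv.range, Submodule.map_top, Submodule.range_subtype]
    have h2 := affineSpan_insert_zero (k := ℝ) (g ⁻¹' C)
    rw [Set.insert_eq_of_mem h0, h1] at h2
    exact SetLike.coe_injective h2
  · intro x hx hx0
    exact hψ _ hx (by rwa [Ne, map_eq_zero_iff g hg])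

theorem setDim_image_closedBall {V : Type*} [AddCommGroup V] [Module ℝ V] {m : ℕ}
    (f : EuclideanSpace ℝ (Fin m) →ᵃ[ℝ] V) :
    setDim (f '' Metric.closedBall 0 1) = Module.finrank ℝ (LinearMap.range f.linear) := by
  have h1 : affineSpan ℝ (Metric.closedBall (0 : EuclideanSpace ℝ (Fin m)) 1) = ⊤ := by
    refine affineSpan_eq_top_of_nonempty_interior ⟨0, ?_⟩
    refine interior_mono (subset_convexHull ℝ _) ?_
    exact Metric.ball_subset_interior_closedBall (Metric.mem_ball_self one_pos)
  have hne : (f '' Metric.closedBall 0 1).Nonempty :=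
    (Metric.nonempty_closedBall.2 zero_le_one).image f
  unfold setDim
  rw [if_neg hne.ne_empty, ← AffineSubspace.map_span, h1, AffineSubspace.map_direction,
    AffineSubspace.direction_top, Submodule.map_top]

theorem isEllipsoidal_of_hasFBI {V : Type*} [AddCommGroup V] [Module ℝ V] [FiniteDimensional ℝ V]
    [TopologicalSpace V] [IsTopologicalAddGroup V] [ContinuousSMul ℝ V] [T2Space V]
    {C : Set V} (hC : IsClosedPointedCone C) (hdim : 2 ≤ setDim C) (hFBI : HasFBI C) :
    IsEllipsoidal C := by
  obtain ⟨n, g, K, hg, rfl, hK⟩ := hC.exists_isSolidCone hdim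
  have htop : affineSpan ℝ K = ⊤ :=
    hK.convex.interior_nonempty_iff_affineSpan_eq_top.1 hK.interior_nonempty
  have hdimC := setDim_image g hg K
  rw [setDim_of_affineSpan_eq_top htop] at hdimC
  have hE : 2 ≤ Module.finrank ℝ (EuclideanSpace ℝ (Fin n)) := by
    rw [hdimC] at hdim
    exact_mod_cast hdim
  rw [hasFBI_image_iff g hg hK.interior_nonempty] at hFBI
  obtain ⟨φ, hφ⟩ := hK.exists_isFlatFamily hE (by
    intro a ha
    have h1 := hFBI a ha
    unfold setDim at h1
    split_ifs at h1 with h2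
    · omega
    · omega)
  obtain ⟨m, χ, e, q, hχe, hq, hrange, hsec⟩ := hφ.exists_ellipsoidal_section hK hE
  obtain ⟨π, hπ⟩ := LinearMap.exists_leftInverse_of_injective g (LinearMap.ker_eq_bot.2 hg)
  have hπg : ∀ x, π (g x) = x := fun x => LinearMap.congr_fun hπ x
  let ψ : V →ₗ[ℝ] ℝ := χ ∘ₗ π
  have hψg : ∀ x, ψ (g x) = χ x := fun x => by simp [ψ, hπg]
  let f : EuclideanSpace ℝ (Fin m) →ᵃ[ℝ] V :=
    (g ∘ₗ q).toAffineMap + AffineMap.const ℝ _ (g e)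
  have hf : ∀ y, f y = g (e + q y) := fun y => by simp [f, add_comm]
  have hlin : f.linear = g ∘ₗ q := by simp [f]
  have himage : g '' K ∩ (AffineSubspace.mk' (g e) (LinearMap.ker ψ) : Set V) =
      f '' Metric.closedBall 0 1 := by
    have h1 : f '' Metric.closedBall 0 1 = g '' (K ∩ {x | χ x = 1}) := by
      rw [hsec, Set.image_image]
      exact Set.image_congr fun y _ => hf y
    rw [h1]
    ext x
    simp only [Set.mem_inter_iff, SetLike.mem_coe, AffineSubspace.mem_mk', LinearMap.mem_ker,
      vsub_eq_sub, map_sub, hψg, hχe, sub_eq_zero]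
    constructor
    · rintro ⟨⟨x, hx, rfl⟩, h2⟩
      exact ⟨x, ⟨hx, by rwa [hψg] at h2⟩, rfl⟩
    · rintro ⟨x, ⟨hx, h2⟩, rfl⟩
      exact ⟨⟨x, hx, rfl⟩, by rw [hψg]; exact h2⟩
  refine ⟨_, ⟨⟨AffineSubspace.mk' (g e) (LinearMap.ker ψ), ⟨⟨g e, AffineSubspace.self_mem_mk' _ _⟩,
    ?_⟩, himage.symm⟩, ?_⟩, m, f, rfl⟩
  · rw [AffineSubspace.direction_mk']
    refine Module.Dual.finrank_ker_add_one_of_ne_zero (f := ψ) fun h0 => ?_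
    have := hψg e
    rw [h0, hχe] at this
    simp at this
  · have h1 : Module.finrank ℝ (LinearMap.ker χ) + 1 =
        Module.finrank ℝ (EuclideanSpace ℝ (Fin n)) :=
      Module.Dual.finrank_ker_add_one_of_ne_zero (f := χ) fun h0 => by simp [h0] at hχe
    rw [setDim_image_closedBall, hdimC, hlin, LinearMap.range_comp, hrange,
      ← (Submodule.equivMapOfInjective g hg _).finrank_eq]
    omega

/-- Ellipsoids contain no rays. -/
theorem IsEllipsoid.eq_zero_of_ray {V : Type*} [AddCommGroup V] [Module ℝ V] {S : Set V}
    (hS : IsEllipsoid S) {x d : V} (h : ∀ t : ℝ, 0 ≤ t → x + t • d ∈ S) : d = 0 := by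
  obtain ⟨m, f, rfl⟩ := hS
  rw [← Module.forall_dual_apply_eq_zero_iff ℝ]
  intro u
  by_contra hu
  have hc : Continuous (u.toAffineMap.comp f) := AffineMap.continuous_of_finiteDimensional _
  obtain ⟨R, hR⟩ := ((isCompact_closedBall (0 : EuclideanSpace ℝ (Fin m)) 1).image
    hc).isBounded.exists_norm_le
  have hbound : ∀ t : ℝ, 0 ≤ t → |u x + t * u d| ≤ R := by
    intro t ht
    obtain ⟨y, hy, hyx⟩ := h t ht
    have := hR _ ⟨y, hy, rfl⟩
    simpa [hyx] using this
  have hR0 : 0 ≤ R := (abs_nonneg _).trans (hbound 0 le_rfl)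
  have hud : 0 < |u d| := abs_pos.2 hu
  have h1 := hbound ((R + |u x| + 1) / |u d|) (by positivity)
  have h2 := abs_sub_abs_le_abs_sub ((R + |u x| + 1) / |u d| * u d) (-u x)
  rw [abs_mul, abs_of_nonneg (by positivity : 0 ≤ (R + |u x| + 1) / |u d|),
    div_mul_cancel₀ _ hud.ne', abs_neg, sub_neg_eq_add, add_comm (_ * _)] at h2
  linarith

/-- An ellipsoidal cone is the injective linear image of the cone over a Euclidean ball. -/
theorem exists_ballCone_of_isEllipsoidal {V : Type*} [AddCommGroup V] [Module ℝ V]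
    [FiniteDimensional ℝ V] [TopologicalSpace V]
    {C : Set V} (hC : IsClosedPointedCone C) (hdim : 2 ≤ setDim C) (hell : IsEllipsoidal C) :
    ∃ (m : ℕ) (F : Submodule ℝ (EuclideanSpace ℝ (Fin m))) (g : ℝ × F →ₗ[ℝ] V),
      Function.Injective g ∧ C = g '' ballCone F := by
  obtain ⟨ψ₀, hψ₀⟩ := hC.exists_pos hdim
  obtain ⟨S, ⟨⟨H, hH, hSH⟩, hSdim⟩, hS⟩ := hell
  obtain ⟨m, f, hf⟩ := id hS
  have he : f 0 ∈ S := hf ▸ ⟨0, Metric.mem_closedBall_self zero_le_one, rfl⟩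
  set e := f 0 with hedef
  have heCH : e ∈ C ∧ e ∈ H := by rw [hSH] at he; exact he
  -- a hyperplane through the origin would cut out a subcone, which is unbounded or trivial
  have hH0 : (0 : V) ∉ H := by
    intro h0
    have hS0 : S ⊆ {0} := by
      intro s hs
      rw [hSH] at hs
      refine hS.eq_zero_of_ray (x := 0) (d := s) fun t ht => ?_
      rw [hSH, zero_add]
      refine ⟨hC.smul_mem s hs.1 t ht, ?_⟩
      have := AffineMap.lineMap_mem t h0 hs.2
      simpa [AffineMap.lineMap_apply] using this
    have hS1 : S = {0} := hS0.antisymm (by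
      have := hS0 he
      rw [Set.mem_singleton_iff] at this
      rwa [Set.singleton_subset_iff, ← this])
    have : setDim S = 0 := by
      rw [hS1]
      simp [setDim, direction_affineSpan]
    omega
  have hed : e ∉ H.direction := by
    intro hed
    apply hH0
    have := AffineSubspace.vadd_mem_of_mem_direction (H.direction.neg_mem hed) heCH.2
    simpa using this
  obtain ⟨u, hue, hu⟩ := Submodule.exists_le_ker_of_notMem hed
  have hker : H.direction = LinearMap.ker u := by
    have := Module.Dual.finrank_ker_add_one_of_ne_zero (f := u) (fun h0 => hue (by simp [h0]))
    have := hH.2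
    exact Submodule.eq_of_le_of_finrank_eq hu (by omega)
  let ψ : V →ₗ[ℝ] ℝ := (u e)⁻¹ • u
  have hψe : ψ e = 1 := by simp [ψ, hue]
  have hψH : ∀ x, x ∈ H ↔ ψ x = 1 := by
    intro x
    have h1 : x ∈ H ↔ x - e ∈ H.direction :=
      (AffineSubspace.vsub_right_mem_direction_iff_mem heCH.2 x).symm
    have h2 : ψ x = 1 ↔ ψ (x - e) = 0 := by rw [map_sub, hψe, sub_eq_zero]
    rw [h1, h2, hker, LinearMap.mem_ker]
    simp [ψ, hue]
  have hSmem : ∀ x, x ∈ S ↔ x ∈ C ∧ ψ x = 1 := by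
    intro x
    rw [hSH, ← hψH]
    rfl
  have hψpos : ∀ x ∈ C, x ≠ 0 → 0 < ψ x := by
    intro x hx hx0
    by_contra! hle
    have h1 : (-ψ x) • e + x = 0 := by
      refine hS.eq_zero_of_ray (x := e) fun t ht => ?_
      rw [hSmem]
      refine ⟨hC.add_mem heCH.1 (hC.smul_mem _ (hC.add_mem (hC.smul_mem e heCH.1 _ (by linarith)) hx)
        t ht), ?_⟩
      simp [hψe]
    have h2 := hψ₀ x hx hx0
    have h3 := hψ₀ e heCH.1 (by intro h0; simp [h0] at hψe)
    have h4 := congrArg ψ₀ h1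
    simp only [map_add, map_smul, smul_eq_mul, map_zero] at h4
    nlinarith
  let L : EuclideanSpace ℝ (Fin m) →ₗ[ℝ] V := f.linear
  have hfL : ∀ y, f y = e + L y := by
    intro y
    have := f.map_vadd 0 y
    simp only [vadd_eq_add, add_zero] at this
    rw [this, add_comm]
  have hψL : ∀ y, ψ (L y) = 0 := by
    have hball : ∀ y, ‖y‖ ≤ 1 → ψ (L y) = 0 := by
      intro y hy
      have h1 : f y ∈ S := hf ▸ ⟨y, by simpa using hy, rfl⟩
      have h2 := ((hSmem _).1 h1).2
      rw [hfL, map_add, hψe] at h2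
      linarith
    intro y
    have h1 := hball ((‖y‖ + 1)⁻¹ • y) (by
      rw [norm_smul, norm_inv, Real.norm_eq_abs, abs_of_pos (by positivity), inv_mul_le_iff₀
        (by positivity)]
      linarith)
    rw [map_smul, map_smul, smul_eq_mul] at h1
    exact (mul_eq_zero.1 h1).resolve_left (by positivity)
  -- restricting `L` to this complement makes it injective without changing the image of the ball
  let F := (LinearMap.ker L)ᗮ
  have hproj : ∀ y, ∃ z : F, L z = L y ∧ ‖z‖ ≤ ‖y‖ := by
    intro y
    refine ⟨F.orthogonalProjectionOnto y, ?_, F.norm_orthogonalProjectionOnto_apply_le y⟩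
    have h1 := F.sub_starProjection_mem_orthogonal y
    rw [Submodule.orthogonal_orthogonal, LinearMap.mem_ker, map_sub, sub_eq_zero] at h1
    exact h1.symm
  let g : ℝ × F →ₗ[ℝ] V :=
    (LinearMap.toSpanSingleton ℝ V e).coprod (L ∘ₗ F.subtype)
  have hgapp : ∀ p : ℝ × F, g p = p.1 • e + L p.2 := fun p => by simp [g]
  refine ⟨m, F, g, ?_, ?_⟩
  · rw [injective_iff_map_eq_zero]
    intro p hp
    rw [hgapp] at hp
    have h1 : p.1 = 0 := by
      have := congrArg ψ hp
      simpa [hψe, hψL] using this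
    rw [h1, zero_smul, zero_add] at hp
    have h2 : (p.2 : EuclideanSpace ℝ (Fin m)) = 0 :=
      inner_self_eq_zero (𝕜 := ℝ).1 (p.2.2 _ hp)
    ext1
    · exact h1
    · exact Subtype.ext h2
  · ext x
    constructor
    · intro hx
      by_cases hx0 : x = 0
      · exact ⟨0, by simp [ballCone], by simp [hx0]⟩
      have hp := hψpos x hx hx0
      have h1 : (ψ x)⁻¹ • x ∈ S := by
        rw [hSmem]
        exact ⟨hC.smul_mem x hx _ (by positivity), by simp [hp.ne']⟩
      rw [hf] at h1
      obtain ⟨y, hy, hyx⟩ := h1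
      obtain ⟨z, hz, hzy⟩ := hproj y
      refine ⟨(ψ x, ψ x • z), ?_, ?_⟩
      · have h2 : ‖z‖ ≤ 1 := hzy.trans (by simpa using hy)
        show ‖ψ x • z‖ ≤ ψ x
        rw [norm_smul, Real.norm_eq_abs, abs_of_pos hp]
        nlinarith
      · rw [hgapp]
        simp only [Submodule.coe_smul, map_smul, hz]
        rw [← smul_add, ← hfL, hyx, smul_smul, mul_inv_cancel₀ hp.ne', one_smul]
    · rintro ⟨⟨t, z⟩, hz, rfl⟩
      have hz' : ‖z‖ ≤ t := hz
      rw [hgapp]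
      rcases ((norm_nonneg z).trans hz').eq_or_lt with h0 | ht
      · have h1 : z = 0 := by
          rw [← norm_le_zero_iff]; rwa [h0]
        simpa [← h0, h1] using hC.smul_mem e heCH.1 0 le_rfl
      · have h1 : f (t⁻¹ • (z : EuclideanSpace ℝ (Fin m))) ∈ S := by
          rw [hf]
          refine ⟨_, ?_, rfl⟩
          rw [mem_closedBall_zero_iff, norm_smul, norm_inv, Real.norm_eq_abs, abs_of_pos ht,
            inv_mul_le_iff₀ ht, mul_one]
          exact hz'
        have h2 := hC.smul_mem _ ((hSmem _).1 h1).1 t ht.le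
        rw [hfL, smul_add, map_smul, smul_smul, mul_inv_cancel₀ ht.ne', one_smul] at h2
        exact h2

theorem hasFBI_of_isEllipsoidal {V : Type*} [AddCommGroup V] [Module ℝ V] [FiniteDimensional ℝ V]
    [TopologicalSpace V] [IsTopologicalAddGroup V] [ContinuousSMul ℝ V] [T2Space V]
    {C : Set V} (hC : IsClosedPointedCone C) (hdim : 2 ≤ setDim C) (hell : IsEllipsoidal C) :
    HasFBI C := by
  obtain ⟨m, F, g, hg, rfl⟩ := exists_ballCone_of_isEllipsoidal hC hdim hell
  have hint : (interior (ballCone F)).Nonempty := by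
    rw [interior_ballCone]
    exact ⟨(1, 0), by simp⟩
  have htop : affineSpan ℝ (ballCone F) = ⊤ := affineSpan_eq_top_of_nonempty_interior
    (hint.mono (interior_mono (subset_convexHull ℝ _)))
  have hF : Nontrivial F := by
    rw [setDim_image g hg, setDim_of_affineSpan_eq_top htop, Module.finrank_prod,
      Module.finrank_self] at hdim
    exact Module.nontrivial_of_finrank_pos (R := ℝ) (by omega)
  rw [hasFBI_image_iff g hg hint]
  exact fun a ha => setDim_frontier_inter_ballCone ha

end FBI

theorem theorem1 {V : Type*} [AddCommGroup V] [Module ℝ V] [FiniteDimensional ℝ V]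
    [TopologicalSpace V] [IsTopologicalAddGroup V] [ContinuousSMul ℝ V] [T2Space V]
    (C : Set V) (hC : FBI.IsClosedPointedCone C) (hdim : 2 ≤ FBI.setDim C) :
    FBI.HasFBI C ↔ FBI.IsEllipsoidal C :=
  ⟨FBI.isEllipsoidal_of_hasFBI hC hdim, FBI.hasFBI_of_isEllipsoidal hC hdim⟩
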